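/- Let $G$ be a simple graph with vertex set $V$. For $x,y\in V$ let $\mathrm{rel}(x,y)$ be the one of the three values *equal*, *adjacent*, *distinct and non-adjacent* that describes the pair $(x,y)$. A *quantum automorphism* of $G$ is a pair $(H,u)$ consisting of a complex Hilbert space $H$ of arbitrary (finite or infinite) dimension and a family $u=(u_{xy})_{x,y\in V}$ of orthogonal projections in $B(H)$ such that - $u_{xy}u_{xz}=0$ and $u_{yx}u_{zx}=0$ for all $x,y,z \in V$ with $y\neq z$; - $\sum_{z\in V}u_{xz}=1=\sum_{z\in V}u_{zy}$ for all $x,y\in V$, in the strong operator topology; - $u_{x_1y_1}u_{x_2y_2}=0$ whenever $\mathrm{rel}(x_1,x_2)\neq\mathrm{rel}(y_1,y_2)$. It is *irreducible* if $H\neq 0$ and every $T\in B(H)$ with $Tu_{xy}=u_{xy}T$ for all $x,y\in V$ is a scalar multiple of the identity. The graph $G$ has *no quantum symmetry* if every irreducible quantum automorphism of $G$ is one-dimensional. The infinite Johnson graph $J(\infty,2)$ has as vertices all $2$-element subsets of $\mathbb N$, two of them being adjacent iff their intersection has exactly one element. The Kneser graph $K(\infty,2)$ has the same vertices, two of them being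 adjacent iff they are disjoint. **Proposition.** The Johnson graph $J(\infty,2)$ has no quantum symmetry; moreover, for every quantum automorphism $(H,u)$ of $J(\infty,2)$ the entries $u_{xy}$ pairwise commute. Likewise, the Kneser graph $K(\infty,2)$ has no quantum symmetry, and the entries of every quantum automorphism of $K(\infty,2)$ pairwise commute. -/

import Mathlib

universe v w

namespace QuantumSymmetry

section Graphs

/-- The three possible relations between two vertices of a graph. -/
inductive VertexRel where
  | equal
  | adjacent
  | distinctNonadjacent

open Classical in
/-- The function `rel` describing the adjacency relation of a pair of vertices. -/
noncomputable def rel {V : Type v} (G : SimpleGraph V) (x y : V) : VertexRel :=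
  if x = y then .equal else if G.Adj x y then .adjacent else .distinctNonadjacent

/-- The Johnson graph `J(∞, k)`: its vertices are the `k`-element subsets of `ℕ`, and two of them
are adjacent iff their intersection has `k - 1` elements. -/
def johnsonGraph (k : ℕ) : SimpleGraph {s : Finset ℕ // s.card = k} where
  Adj s t := (s.1 ∩ t.1).card + 1 = k
  symm := ⟨fun s t h => by rw [Finset.inter_comm]; exact h⟩
  loopless := ⟨fun s h => by
    rw [Finset.inter_self, s.2] at h
    omega⟩

/-- The Kneser graph `K(∞, 2)`: its vertices are the `2`-element subsets of `ℕ`, and two of them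
are adjacent iff their intersection is empty. -/
def kneserGraphTwo : SimpleGraph {s : Finset ℕ // s.card = 2} where
  Adj s t := s.1 ∩ t.1 = ∅
  symm := ⟨fun s t h => by rw [Finset.inter_comm]; exact h⟩
  loopless := ⟨fun s h => by
    have h2 := s.2
    rw [Finset.inter_self] at h
    rw [h] at h2
    simp at h2⟩

end Graphs

section Operators

variable {V : Type v} {H : Type w} [NormedAddCommGroup H] [InnerProductSpace ℂ H] [CompleteSpace H]

/-- `(H, u)` is a quantum permutation of the set `V`: the `u x y` are orthogonal projections, those
in a common row or column are pairwise orthogonal, and all rows and columns sum to the identity in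
the strong operator topology. -/
structure IsQuantumPermutation (u : V → V → (H →L[ℂ] H)) : Prop where
  isStarProjection : ∀ x y, IsStarProjection (u x y)
  row_orthogonal : ∀ x y z, y ≠ z → u x y * u x z = 0
  col_orthogonal : ∀ y x z, x ≠ z → u x y * u z y = 0
  row_sum : ∀ x, ∀ ξ : H, HasSum (fun z => u x z ξ) ξ
  col_sum : ∀ y, ∀ ξ : H, HasSum (fun z => u z y ξ) ξ

/-- `(H, u)` is a quantum automorphism of the graph `G`. -/
structure IsQuantumAutomorphism (G : SimpleGraph V) (u : V → V → (H →L[ℂ] H)) : Prop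
    extends IsQuantumPermutation u where
  mul_eq_zero_of_rel_ne : ∀ x₁ x₂ y₁ y₂, rel G x₁ x₂ ≠ rel G y₁ y₂ → u x₁ y₁ * u x₂ y₂ = 0

/-- `(H, u)` is irreducible: `H` is nonzero and the only intertwiners from `(H, u)` to itself are
the multiples of the identity. -/
def IsIrreducible (u : V → V → (H →L[ℂ] H)) : Prop :=
  Nontrivial H ∧
    ∀ T : H →L[ℂ] H, (∀ x y, T * u x y = u x y * T) → ∃ c : ℂ, T = c • (1 : H →L[ℂ] H)

end Operators

/-- A graph has no quantum symmetry if each of its irreducible quantum automorphisms, on a Hilbert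
space of any dimension, is one-dimensional. -/
def HasNoQuantumSymmetry {V : Type v} (G : SimpleGraph V) : Prop :=
  ∀ (H : Type w) [NormedAddCommGroup H] [InnerProductSpace ℂ H] [CompleteSpace H]
    (u : V → V → (H →L[ℂ] H)),
    IsQuantumAutomorphism G u → IsIrreducible u → Module.finrank ℂ H = 1

/-- The entries of each quantum automorphism of the graph, on a Hilbert space of any dimension,
pairwise commute. -/
def QuantumAutomorphismEntriesCommute {V : Type v} (G : SimpleGraph V) : Prop :=
  ∀ (H : Type w) [NormedAddCommGroup H] [InnerProductSpace ℂ H] [CompleteSpace H]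
    (u : V → V → (H →L[ℂ] H)),
    IsQuantumAutomorphism G u → ∀ x y x' y', u x y * u x' y' = u x' y' * u x y

end QuantumSymmetry

/-!
Let `P x e` be the projection onto the event that the image of the pair `e` contains the point `x`,
the sum of the `u e f` over the pairs `f` containing `x`, so that `P x e * P y e = u e {x, y}`. If
`e` and `e'` are disjoint and `g` meets each of them in one point, then `P x g ≤ P x e + P x e'`;
hence, for fixed `x`, the sum `P x {a, b} + P x {c, d}` depends only on the set `{a, b, c, d}`. As
soon as there is a fifth point, this exchange relation forces `P x {a, b} = v x a + v x b` for
projections `v x a`, namely `v x a = P x {a, b} * P x {a, c}` for arbitrary `b ≠ c`. So `u` is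
induced by a quantum permutation `v` of the points, and the commutation of `P x {a, b}` and
`P y {a, b}` makes the entries of `v` commute.
-/

namespace QuantumSymmetry

section ResolutionOfIdentity

variable {ι κ 𝕜 : Type*} {H : Type w} [RCLike 𝕜] [NormedAddCommGroup H] [InnerProductSpace 𝕜 H]
  [CompleteSpace H]

/-- A family of pairwise orthogonal projections summing to the identity in the strong operator
topology, such as a row of a quantum permutation. -/
structure IsResolutionOfIdentity (q : ι → (H →L[𝕜] H)) : Prop where
  isStarProjection : ∀ i, IsStarProjection (q i)
  mul_eq_zero : ∀ i j, i ≠ j → q i * q j = 0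
  hasSum : ∀ ξ, HasSum (fun i => q i ξ) ξ

/-- The sum of the projections `q i`, `i ∈ S`, of a resolution of the identity, encoded as the
projection onto the closed span of their ranges. -/
noncomputable def subsetProj (q : ι → (H →L[𝕜] H)) (S : Set ι) : H →L[𝕜] H :=
  (⨆ i ∈ S, (q i).range).topologicalClosure.starProjection

theorem isStarProjection_subsetProj (q : ι → (H →L[𝕜] H)) (S : Set ι) :
    IsStarProjection (subsetProj q S) :=
  isStarProjection_starProjection

namespace IsResolutionOfIdentity

variable {q : ι → (H →L[𝕜] H)} {r : κ → (H →L[𝕜] H)} {S : Set ι}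

theorem ext_mul_right (hq : IsResolutionOfIdentity q) {s t : H →L[𝕜] H}
    (h : ∀ i, s * q i = t * q i) : s = t := by
  ext ξ
  refine ((hq.hasSum ξ).mapL s).unique ?_
  convert (hq.hasSum ξ).mapL t using 2 with i
  exact congr($(h i) ξ)

theorem ext_mul_left (hq : IsResolutionOfIdentity q) {s t : H →L[𝕜] H}
    (h : ∀ i, q i * s = q i * t) : s = t := by
  ext ξ
  refine (hq.hasSum (s ξ)).unique ?_
  convert hq.hasSum (t ξ) using 2 with i
  exact congr($(h i) ξ)

theorem subsetProj_mul_of_mem {i : ι} (hi : i ∈ S) : subsetProj q S * q i = q i := by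
  ext ξ
  refine Submodule.starProjection_eq_self_iff.2 (Submodule.le_topologicalClosure _ ?_)
  exact Submodule.mem_iSup_of_mem i (Submodule.mem_iSup_of_mem hi ⟨ξ, rfl⟩)

theorem subsetProj_mul_of_notMem (hq : IsResolutionOfIdentity q) {i : ι} (hi : i ∉ S) :
    subsetProj q S * q i = 0 := by
  have hker : (⨆ j ∈ S, (q j).range).topologicalClosure ≤ (q i).ker := by
    refine Submodule.topologicalClosure_minimal _ (iSup₂_le fun j hj => ?_) (q i).isClosed_ker
    rintro _ ⟨ξ, rfl⟩
    exact congr($(hq.mul_eq_zero i j fun hij => hi (hij ▸ hj)) ξ)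
  have hmul : q i * subsetProj q S = 0 := by
    ext ξ
    exact hker (Submodule.starProjection_apply_mem _ ξ)
  simpa only [star_mul, (hq.isStarProjection i).isSelfAdjoint.star_eq,
    (isStarProjection_subsetProj q S).isSelfAdjoint.star_eq, star_zero] using congr(star $hmul)

theorem commute_subsetProj (hq : IsResolutionOfIdentity q) (S : Set ι) (i : ι) :
    Commute (q i) (subsetProj q S) := by
  refine Commute.symm ((IsSelfAdjoint.commute_iff
    (isStarProjection_subsetProj q S).isSelfAdjoint (hq.isStarProjection i).isSelfAdjoint).2 ?_)
  by_cases hi : i ∈ S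
  · rw [subsetProj_mul_of_mem hi]
    exact (hq.isStarProjection i).isSelfAdjoint
  · rw [hq.subsetProj_mul_of_notMem hi]
    exact .zero _

theorem subsetProj_singleton (hq : IsResolutionOfIdentity q) (i : ι) :
    subsetProj q {i} = q i := by
  refine hq.ext_mul_right fun j => ?_
  rcases eq_or_ne j i with rfl | hj
  · rw [subsetProj_mul_of_mem (Set.mem_singleton j), (hq.isStarProjection j).isIdempotentElem.eq]
  · rw [hq.subsetProj_mul_of_notMem (Set.mem_singleton_iff.not.2 hj), hq.mul_eq_zero i j hj.symm]

theorem subsetProj_mul_subsetProj (hq : IsResolutionOfIdentity q) (S T : Set ι) :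
    subsetProj q S * subsetProj q T = subsetProj q (S ∩ T) := by
  refine hq.ext_mul_right fun i => ?_
  by_cases hS : i ∈ S <;> by_cases hT : i ∈ T <;>
    simp [mul_assoc, subsetProj_mul_of_mem, hq.subsetProj_mul_of_notMem, hS, hT]

theorem subsetProj_add_subsetProj (hq : IsResolutionOfIdentity q) (S T : Set ι) :
    subsetProj q S + subsetProj q T = subsetProj q (S ∪ T) + subsetProj q (S ∩ T) := by
  refine hq.ext_mul_right fun i => ?_
  by_cases hS : i ∈ S <;> by_cases hT : i ∈ T <;>
    simp [add_mul, subsetProj_mul_of_mem, hq.subsetProj_mul_of_notMem, hS, hT]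

theorem subsetProj_mul_eq_self (hq : IsResolutionOfIdentity q) {t : H →L[𝕜] H}
    (h : ∀ i ∉ S, q i * t = 0) : subsetProj q S * t = t := by
  refine hq.ext_mul_left fun i => ?_
  rw [← mul_assoc, (hq.commute_subsetProj S i).eq]
  by_cases hi : i ∈ S
  · rw [subsetProj_mul_of_mem hi]
  · rw [hq.subsetProj_mul_of_notMem hi, zero_mul, h i hi]

theorem mul_subsetProj_congr (hq : IsResolutionOfIdentity q) {s t : H →L[𝕜] H}
    (h : ∀ i ∈ S, s * q i = t * q i) : s * subsetProj q S = t * subsetProj q S := by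
  refine hq.ext_mul_right fun i => ?_
  rw [mul_assoc, mul_assoc]
  by_cases hi : i ∈ S
  · rw [subsetProj_mul_of_mem hi, h i hi]
  · rw [hq.subsetProj_mul_of_notMem hi, mul_zero, mul_zero]

theorem subsetProj_mul_subsetProj_eq_zero (hq : IsResolutionOfIdentity q)
    (hr : IsResolutionOfIdentity r) {T : Set κ} (h : ∀ i ∈ S, ∀ j ∈ T, q i * r j = 0) :
    subsetProj q S * subsetProj r T = 0 := by
  have hright : ∀ j ∈ T, subsetProj q S * r j = 0 * r j := fun j hj => by
    refine hq.ext_mul_left fun i => ?_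
    rw [← mul_assoc, (hq.commute_subsetProj S i).eq, zero_mul, mul_zero]
    by_cases hi : i ∈ S
    · rw [subsetProj_mul_of_mem hi, h i hi j hj]
    · rw [hq.subsetProj_mul_of_notMem hi, zero_mul]
  rw [hr.mul_subsetProj_congr hright, zero_mul]

end IsResolutionOfIdentity

theorem finrank_eq_one_of_forall_eq_smul_one {E : Type*} [NormedAddCommGroup E]
    [InnerProductSpace 𝕜 E] [Nontrivial E] (h : ∀ T : E →L[𝕜] E, ∃ c : 𝕜, T = c • 1) :
    Module.finrank 𝕜 E = 1 := by
  obtain ⟨ξ, hξ⟩ := exists_ne (0 : E)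
  refine finrank_eq_one ξ hξ fun η => ?_
  obtain ⟨c, hc⟩ := h (InnerProductSpace.rankOne 𝕜 η ξ)
  have hcξ : inner 𝕜 ξ ξ • η = c • ξ := congr($hc ξ)
  exact ⟨(inner 𝕜 ξ ξ)⁻¹ * c, by
    rw [mul_smul, ← hcξ, inv_smul_smul₀ (inner_self_ne_zero.2 hξ)]⟩

end ResolutionOfIdentity

section CStarAlgebra

theorem mul_eq_self_of_add_mul_eq {R : Type*} [NormedRing R] [StarRing R] [CStarRing R]
    [PartialOrder R] [StarOrderedRing R] {p q t : R} (hp : IsStarProjection p)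
    (hq : IsStarProjection q) (h : (p + q) * t = t + t) : p * t = t := by
  have star_mul_self {r : R} (hr : IsStarProjection r) :
      star (r * t) * (r * t) = star t * (r * t) := by
    rw [star_mul, hr.isSelfAdjoint.star_eq, mul_assoc, ← mul_assoc r r t, hr.isIdempotentElem.eq]
  have hsum : star ((1 - p) * t) * ((1 - p) * t) + star ((1 - q) * t) * ((1 - q) * t) = 0 := by
    rw [star_mul_self hp.one_sub, star_mul_self hq.one_sub, ← mul_add, sub_mul, sub_mul, one_mul,
      sub_add_sub_comm, ← add_mul, h, sub_self, mul_zero]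
  have hzero := ((add_eq_zero_iff_of_nonneg (star_mul_self_nonneg _) (star_mul_self_nonneg _)).1
    hsum).1
  rw [CStarRing.star_mul_self_eq_zero_iff, sub_mul, one_mul, sub_eq_zero] at hzero
  exact hzero.symm

end CStarAlgebra

section Pairs

variable {α : Type v}

theorem exists_ne_of_five_le_card (hα : 5 ≤ ENat.card α) (a b c d : α) :
    ∃ e, a ≠ e ∧ b ≠ e ∧ c ≠ e ∧ d ≠ e := by
  classical
  obtain ⟨e, he⟩ : ∃ e, e ∉ ({a, b, c, d} : Finset α) := by
    by_contra! h
    have huniv : (({a, b, c, d} : Finset α) : Set α) = Set.univ := Set.eq_univ_of_forall h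
    rw [← Set.encard_univ, ← huniv, Set.encard_coe_eq_coe_finsetCard] at hα
    have hfive : 5 ≤ ({a, b, c, d} : Finset α).card := by exact_mod_cast hα
    have hfour := Finset.card_le_four (a := a) (b := b) (c := c) (d := d)
    omega
  exact ⟨e, by simpa [eq_comm] using he⟩

/-- The vertices of the Johnson and Kneser graphs on a set of points `α`. -/
abbrev Pair (α : Type v) := {s : Finset α // s.card = 2}

variable [DecidableEq α] {a b c d : α}

/-- The pair `{a, b}` of two distinct points. -/
def pair (hab : a ≠ b) : Pair α :=
  ⟨{a, b}, Finset.card_pair hab⟩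

theorem pair_comm (hab : a ≠ b) : pair hab.symm = pair hab :=
  Subtype.ext (Finset.pair_comm b a)

theorem exists_eq_pair (e : Pair α) : ∃ a b, ∃ hab : a ≠ b, e = pair hab := by
  obtain ⟨a, b, hab, he⟩ := Finset.card_eq_two.1 e.2
  exact ⟨a, b, hab, Subtype.ext he⟩

theorem eq_pair_iff_mem (hab : a ≠ b) {e : Pair α} : e = pair hab ↔ a ∈ e.1 ∧ b ∈ e.1 := by
  obtain ⟨c, d, hcd, rfl⟩ := exists_eq_pair e
  rw [Subtype.ext_iff]
  simp only [pair]
  grind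

theorem exists_eq_pair_of_mem {e : Pair α} (ha : a ∈ e.1) : ∃ b, ∃ hab : a ≠ b, e = pair hab := by
  obtain ⟨b, hb, hba⟩ := Finset.exists_mem_ne (e.2 ▸ one_lt_two) a
  exact ⟨b, hba.symm, (eq_pair_iff_mem hba.symm).2 ⟨ha, hb⟩⟩

theorem card_inter_eq_two_iff {e f : Pair α} : (e.1 ∩ f.1).card = 2 ↔ e = f := by
  constructor
  · intro h
    have he : e.1 ∩ f.1 = e.1 :=
      Finset.eq_of_subset_of_card_le Finset.inter_subset_left (by rw [h, e.2])
    have hf : e.1 ∩ f.1 = f.1 :=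
      Finset.eq_of_subset_of_card_le Finset.inter_subset_right (by rw [h, f.2])
    exact Subtype.ext (he.symm.trans hf)
  · rintro rfl
    rw [Finset.inter_self, e.2]

theorem card_inter_pair_pair (hab : a ≠ b) (hac : a ≠ c) (hbc : b ≠ c) :
    ((pair hab).1 ∩ (pair hac).1).card = 1 := by
  have hinter : (pair hab).1 ∩ (pair hac).1 = {a} := by
    simp only [pair]
    grind
  rw [hinter, Finset.card_singleton]

theorem disjoint_pair_pair (hab : a ≠ b) (hcd : c ≠ d) (hac : a ≠ c) (had : a ≠ d) (hbc : b ≠ c)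
    (hbd : b ≠ d) : Disjoint (pair hab).1 (pair hcd).1 := by
  simp [pair, hac.symm, had.symm, hbc.symm, hbd.symm]

theorem card_inter_eq_of_rel_eq {G : SimpleGraph (Pair α)} {k : ℕ} (hk : k < 2)
    (hG : ∀ e f, G.Adj e f ↔ (e.1 ∩ f.1).card = k) {e f e' f' : Pair α}
    (h : rel G e f = rel G e' f') : (e.1 ∩ f.1).card = (e'.1 ∩ f'.1).card := by
  have hcard (s t : Pair α) : (s.1 ∩ t.1).card ≤ 2 :=
    (Finset.card_le_card Finset.inter_subset_left).trans s.2.le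
  have hef := hcard e f
  have hef' := hcard e' f'
  simp only [rel, ← card_inter_eq_two_iff, hG] at h
  split_ifs at h <;> omega

end Pairs

section ExchangeFamily

variable {α : Type v} {R : Type*} [DecidableEq α] [NonUnitalRing R] [StarRing R] {p : Pair α → R}
  {v : α → R}

/-- A family of projections indexed by pairs, orthogonal for disjoint pairs, such that
`p {a, b} + p {c, d}` depends only on the set `{a, b, c, d}`. -/
structure IsExchangeFamily (p : Pair α → R) : Prop where
  isStarProjection : ∀ e, IsStarProjection (p e)
  mul_eq_zero : ∀ e f, Disjoint e.1 f.1 → p e * p f = 0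
  exchange : ∀ {a b c d : α} (hab : a ≠ b) (hcd : c ≠ d) (hac : a ≠ c) (hbd : b ≠ d),
    a ≠ d → b ≠ c → p (pair hab) + p (pair hcd) = p (pair hac) + p (pair hbd)

/-- `v a` is the common value of the products `p {a, b} * p {a, c}` with `b ≠ c`: the part of
`p {a, b}` belonging to the point `a`. -/
def IsPointFactor (p : Pair α → R) (v : α → R) : Prop :=
  ∀ ⦃a b c : α⦄ (hab : a ≠ b) (hac : a ≠ c), b ≠ c → p (pair hab) * p (pair hac) = v a

namespace IsExchangeFamily

theorem mul_pair_congr (hp : IsExchangeFamily p) (hα : 5 ≤ ENat.card α) {a b c d : α}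
    (hab : a ≠ b) (hac : a ≠ c) (had : a ≠ d) (hbc : b ≠ c) (hbd : b ≠ d) :
    p (pair hab) * p (pair hac) = p (pair hab) * p (pair had) := by
  rcases eq_or_ne c d with rfl | hcd
  · rfl
  obtain ⟨e, hae, hbe, hce, hde⟩ := exists_ne_of_five_le_card hα a b c d
  have hexch : p (pair hac) + p (pair hde) = p (pair had) + p (pair hce) :=
    hp.exchange hac hde had hce hae hcd
  have hzero_de : p (pair hab) * p (pair hde) = 0 :=
    hp.mul_eq_zero _ _ (disjoint_pair_pair hab hde had hae hbd hbe)
  have hzero_ce : p (pair hab) * p (pair hce) = 0 :=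
    hp.mul_eq_zero _ _ (disjoint_pair_pair hab hce hac hae hbc hbe)
  simpa only [mul_add, hzero_de, hzero_ce, add_zero] using congr(p (pair hab) * $hexch)

theorem pair_mul_congr (hp : IsExchangeFamily p) (hα : 5 ≤ ENat.card α) {a b c d : α}
    (hab : a ≠ b) (hac : a ≠ c) (had : a ≠ d) (hbc : b ≠ c) (hbd : b ≠ d) :
    p (pair hac) * p (pair hab) = p (pair had) * p (pair hab) := by
  simpa only [star_mul, (hp.isStarProjection _).isSelfAdjoint.star_eq] using
    congr(star $(hp.mul_pair_congr hα hab hac had hbc hbd))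

theorem commute_pair (hp : IsExchangeFamily p) (hα : 5 ≤ ENat.card α) {a b c : α}
    (hab : a ≠ b) (hac : a ≠ c) (hbc : b ≠ c) : Commute (p (pair hab)) (p (pair hac)) := by
  obtain ⟨d, had, hbd, hcd, -⟩ := exists_ne_of_five_le_card hα a b c c
  calc p (pair hab) * p (pair hac)
      = p (pair hab) * p (pair had) := hp.mul_pair_congr hα hab hac had hbc hbd
    _ = p (pair hac) * p (pair had) := hp.pair_mul_congr hα had hab hac hbd.symm hcd.symm
    _ = p (pair hac) * p (pair hab) := hp.mul_pair_congr hα hac had hab hcd hbc.symm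

theorem pair_mul_pair_congr (hp : IsExchangeFamily p) (hα : 5 ≤ ENat.card α) {a b c b' c' : α}
    (hab : a ≠ b) (hac : a ≠ c) (hab' : a ≠ b') (hac' : a ≠ c') (hbc : b ≠ c) (hbc' : b' ≠ c') :
    p (pair hab) * p (pair hac) = p (pair hab') * p (pair hac') := by
  rcases eq_or_ne b' c with rfl | hcb'
  · rw [(hp.commute_pair hα hab hab' hbc).eq, hp.mul_pair_congr hα hab' hab hac' hbc.symm hbc']
  · rw [hp.pair_mul_congr hα hac hab hab' hbc.symm hcb'.symm,
      hp.mul_pair_congr hα hab' hac hac' hcb' hbc']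

theorem exists_isPointFactor (hp : IsExchangeFamily p) (hα : 5 ≤ ENat.card α) :
    ∃ v, IsPointFactor p v := by
  have hpoint (a : α) : ∃ w, ∀ b c (hab : a ≠ b) (hac : a ≠ c), b ≠ c →
      p (pair hab) * p (pair hac) = w := by
    obtain ⟨b, hab, -⟩ := exists_ne_of_five_le_card hα a a a a
    obtain ⟨c, hac, hbc, -⟩ := exists_ne_of_five_le_card hα a b b b
    exact ⟨p (pair hab) * p (pair hac), fun _ _ hab' hac' hbc' =>
      hp.pair_mul_pair_congr hα hab' hac' hab hac hbc' hbc⟩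
  choose v hv using hpoint
  exact ⟨v, hv⟩

theorem isStarProjection_point (hp : IsExchangeFamily p) (hα : 5 ≤ ENat.card α)
    (hv : IsPointFactor p v) (a : α) : IsStarProjection (v a) := by
  obtain ⟨b, hab, -⟩ := exists_ne_of_five_le_card hα a a a a
  obtain ⟨c, hac, hbc, -⟩ := exists_ne_of_five_le_card hα a b b b
  rw [← hv hab hac hbc]
  exact (hp.isStarProjection _).mul (hp.isStarProjection _) (hp.commute_pair hα hab hac hbc)

theorem point_mul_point (hp : IsExchangeFamily p) (hα : 5 ≤ ENat.card α)
    (hv : IsPointFactor p v) {a b : α} (hab : a ≠ b) : v a * v b = 0 := by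
  obtain ⟨c, hac, hbc, -⟩ := exists_ne_of_five_le_card hα a b b b
  obtain ⟨d, had, hbd, hcd, -⟩ := exists_ne_of_five_le_card hα a b c c
  have hzero : p (pair hac) * p (pair hbd) = 0 :=
    hp.mul_eq_zero _ _ (disjoint_pair_pair hac hbd hab had hbc.symm hcd)
  rw [← hv had hac hcd.symm, ← hv hbd hbc hcd.symm, mul_assoc, ← mul_assoc (p (pair hac)), hzero,
    zero_mul, mul_zero]

theorem pair_eq_point_add_point (hp : IsExchangeFamily p) (hα : 5 ≤ ENat.card α)
    (hv : IsPointFactor p v) {a b : α} (hab : a ≠ b) : p (pair hab) = v a + v b := by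
  obtain ⟨c, hac, hbc, -⟩ := exists_ne_of_five_le_card hα a b b b
  obtain ⟨d, had, hbd, hcd, -⟩ := exists_ne_of_five_le_card hα a b c c
  calc p (pair hab)
      = p (pair hab) * (p (pair hab) + p (pair hcd)) := by
        rw [mul_add, (hp.isStarProjection _).isIdempotentElem.eq,
          hp.mul_eq_zero _ _ (disjoint_pair_pair hab hcd hac had hbc hbd), add_zero]
    _ = p (pair hab) * p (pair hac) + p (pair hab) * p (pair hbd) := by
        rw [hp.exchange hab hcd hac hbd had hbc, mul_add]
    _ = v a + v b := by
        rw [hv hab hac hbc, ← pair_comm hab, hv hab.symm hbd had]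

end IsExchangeFamily

end ExchangeFamily

section PairPermutation

variable {α : Type v} [DecidableEq α] {H : Type w} [NormedAddCommGroup H] [InnerProductSpace ℂ H]
  [CompleteSpace H] {u : Pair α → Pair α → (H →L[ℂ] H)} {v : α → α → (H →L[ℂ] H)}

/-- A quantum permutation of the pairs preserving the size of intersections. Of the quantum
permutation only the conditions on the rows are recorded. -/
structure PreservesIntersections (u : Pair α → Pair α → (H →L[ℂ] H)) : Prop where
  row : ∀ e, IsResolutionOfIdentity (u e)
  mul_eq_zero : ∀ e e' f f', (e.1 ∩ e'.1).card ≠ (f.1 ∩ f'.1).card → u e f * u e' f' = 0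

/-- The projection onto the event that the image of the pair `e` contains the point `x`. -/
noncomputable def pointProj (u : Pair α → Pair α → (H →L[ℂ] H)) (x : α) (e : Pair α) : H →L[ℂ] H :=
  subsetProj (u e) {f | x ∈ f.1}

namespace PreservesIntersections

theorem pointProj_mul_of_disjoint (hu : PreservesIntersections u) {e e' : Pair α}
    (he : Disjoint e.1 e'.1) (x : α) : pointProj u x e * pointProj u x e' = 0 :=
  (hu.row e).subsetProj_mul_subsetProj_eq_zero (hu.row e') fun f hf f' hf' =>
    hu.mul_eq_zero _ _ _ _ <| by
      rw [Finset.disjoint_iff_inter_eq_empty.1 he, Finset.card_empty]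
      exact (Finset.card_pos.2 ⟨x, Finset.mem_inter.2 ⟨hf, hf'⟩⟩).ne

theorem pointProj_mul_pointProj (hu : PreservesIntersections u) (e : Pair α) {x y : α}
    (hxy : x ≠ y) : pointProj u x e * pointProj u y e = u e (pair hxy) := by
  have hinter : {f : Pair α | x ∈ f.1} ∩ {f | y ∈ f.1} = {pair hxy} :=
    Set.ext fun _ => (eq_pair_iff_mem hxy).symm
  rw [pointProj, pointProj, (hu.row e).subsetProj_mul_subsetProj, hinter,
    (hu.row e).subsetProj_singleton]

theorem pointProj_add_mul_entry (hu : PreservesIntersections u) {e g : Pair α}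
    (heg : (e.1 ∩ g.1).card = 1) {x y : α} (hxy : x ≠ y) :
    (pointProj u x e + pointProj u y e) * u g (pair hxy) = u g (pair hxy) := by
  have hunion : subsetProj (u e) ({f | x ∈ f.1} ∪ {f | y ∈ f.1}) * u g (pair hxy)
      = u g (pair hxy) := by
    refine (hu.row e).subsetProj_mul_eq_self fun f hf => hu.mul_eq_zero _ _ _ _ ?_
    have hdisj : Disjoint f.1 (pair hxy).1 := by simpa [pair] using hf
    simp [heg, Finset.disjoint_iff_inter_eq_empty.1 hdisj]
  have hinter : u e (pair hxy) * u g (pair hxy) = 0 :=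
    hu.mul_eq_zero _ _ _ _ (by simp [heg, (pair hxy).2])
  have hadd : pointProj u x e + pointProj u y e
      = subsetProj (u e) ({f | x ∈ f.1} ∪ {f | y ∈ f.1}) + u e (pair hxy) := by
    rw [← hu.pointProj_mul_pointProj e hxy, pointProj, pointProj,
      (hu.row e).subsetProj_add_subsetProj, (hu.row e).subsetProj_mul_subsetProj]
  rw [hadd, add_mul, hunion, hinter, add_zero]

theorem isStarProjection_pointProj_add (hu : PreservesIntersections u) {e e' : Pair α}
    (he : Disjoint e.1 e'.1) (x : α) : IsStarProjection (pointProj u x e + pointProj u x e') :=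
  (isStarProjection_subsetProj _ _).add (isStarProjection_subsetProj _ _)
    (hu.pointProj_mul_of_disjoint he x)

theorem pointProj_add_mul_pointProj (hu : PreservesIntersections u) {e e' g : Pair α}
    (he : Disjoint e.1 e'.1) (heg : (e.1 ∩ g.1).card = 1) (heg' : (e'.1 ∩ g.1).card = 1) (x : α) :
    (pointProj u x e + pointProj u x e') * pointProj u x g = pointProj u x g := by
  have hmul : ∀ f ∈ {f : Pair α | x ∈ f.1},
      (pointProj u x e + pointProj u x e') * u g f = 1 * u g f := by
    intro f hf
    obtain ⟨y, hxy, rfl⟩ := exists_eq_pair_of_mem hf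
    rw [one_mul]
    refine mul_eq_self_of_add_mul_eq (hu.isStarProjection_pointProj_add he x)
      (hu.isStarProjection_pointProj_add he y) ?_
    rw [add_add_add_comm, add_mul, hu.pointProj_add_mul_entry heg hxy,
      hu.pointProj_add_mul_entry heg' hxy]
  exact ((hu.row g).mul_subsetProj_congr hmul).trans (one_mul _)

theorem pointProj_add_le (hu : PreservesIntersections u) {a b c d : α} (hab : a ≠ b) (hcd : c ≠ d)
    (hac : a ≠ c) (hbd : b ≠ d) (had : a ≠ d) (hbc : b ≠ c) (x : α) :
    pointProj u x (pair hac) + pointProj u x (pair hbd) ≤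
      pointProj u x (pair hab) + pointProj u x (pair hcd) := by
  have hdisj := disjoint_pair_pair hab hcd hac had hbc hbd
  have hdisj' := disjoint_pair_pair hac hbd hab had hbc.symm hcd
  refine (hu.isStarProjection_pointProj_add hdisj' x).le_of_mul_eq_right
    (hu.isStarProjection_pointProj_add hdisj x) ?_
  rw [mul_add]
  congr 1
  · refine hu.pointProj_add_mul_pointProj hdisj (card_inter_pair_pair hab hac hbc) ?_ x
    rw [← pair_comm hac]
    exact card_inter_pair_pair hcd hac.symm had.symm
  · refine hu.pointProj_add_mul_pointProj hdisj ?_ ?_ x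
    · rw [← pair_comm hab]
      exact card_inter_pair_pair hab.symm hbd had
    · rw [← pair_comm hcd, ← pair_comm hbd]
      exact card_inter_pair_pair hcd.symm hbd.symm hbc.symm

theorem isExchangeFamily (hu : PreservesIntersections u) (x : α) :
    IsExchangeFamily (pointProj u x) where
  isStarProjection _ := isStarProjection_subsetProj _ _
  mul_eq_zero _ _ he := hu.pointProj_mul_of_disjoint he x
  exchange hab hcd hac hbd had hbc :=
    le_antisymm (hu.pointProj_add_le hac hbd hab hcd had hbc.symm x)
      (hu.pointProj_add_le hab hcd hac hbd had hbc x)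

theorem point_row_orthogonal (hu : PreservesIntersections u) (hα : 5 ≤ ENat.card α)
    (hv : ∀ x, IsPointFactor (pointProj u x) (v x)) (a : α) {x y : α} (hxy : x ≠ y) :
    v x a * v y a = 0 := by
  obtain ⟨b, hab, -⟩ := exists_ne_of_five_le_card hα a a a a
  obtain ⟨c, hac, hbc, -⟩ := exists_ne_of_five_le_card hα a b b b
  have hself (z : α) : IsSelfAdjoint (v z a) :=
    ((hu.isExchangeFamily z).isStarProjection_point hα (hv z) a).isSelfAdjoint
  have hzero : u (pair hab) (pair hxy.symm) * u (pair hac) (pair hxy) = 0 :=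
    hu.mul_eq_zero _ _ _ _ (by
      rw [pair_comm hxy, card_inter_pair_pair hab hac hbc, Finset.inter_self, (pair hxy).2]
      decide)
  have hsandwich : v y a * v x a * v y a = 0 := by
    calc v y a * v x a * v y a
        = pointProj u y (pair hac)
            * ((pointProj u y (pair hab) * pointProj u x (pair hab))
              * (pointProj u x (pair hac) * pointProj u y (pair hac)))
            * pointProj u y (pair hab) := by
          nth_rw 1 [← hv y hac hab hbc.symm]
          rw [← hv x hab hac hbc, ← hv y hac hab hbc.symm]
          simp only [mul_assoc]
      _ = 0 := by
          rw [hu.pointProj_mul_pointProj _ hxy.symm, hu.pointProj_mul_pointProj _ hxy, hzero,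
            mul_zero, zero_mul]
  rw [← CStarRing.star_mul_self_eq_zero_iff, star_mul, (hself x).star_eq, (hself y).star_eq,
    mul_assoc, ← mul_assoc (v x a), ((hu.isExchangeFamily x).isStarProjection_point hα (hv x)
      a).isIdempotentElem.eq, ← mul_assoc, hsandwich]

theorem commute_pointProj_row (hu : PreservesIntersections u) (e : Pair α) (x y : α) :
    Commute (pointProj u x e) (pointProj u y e) := by
  rcases eq_or_ne x y with rfl | hxy
  · exact .refl _
  · rw [commute_iff_eq, hu.pointProj_mul_pointProj e hxy, hu.pointProj_mul_pointProj e hxy.symm,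
      pair_comm]

theorem commute_point (hu : PreservesIntersections u) (hα : 5 ≤ ENat.card α)
    (hv : ∀ x, IsPointFactor (pointProj u x) (v x)) (x y a b : α) :
    Commute (v x a) (v y b) := by
  have hproj (z c : α) : IsStarProjection (v z c) :=
    (hu.isExchangeFamily z).isStarProjection_point hα (hv z) c
  have horth (z : α) {c d : α} (hcd : c ≠ d) : v z c * v z d = 0 :=
    (hu.isExchangeFamily z).point_mul_point hα (hv z) hcd
  rcases eq_or_ne x y with rfl | hxy
  · rcases eq_or_ne a b with rfl | hab
    · exact .refl _
    · rw [commute_iff_eq, horth x hab, horth x hab.symm]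
  rcases eq_or_ne a b with rfl | hab
  · rw [commute_iff_eq, hu.point_row_orthogonal hα hv a hxy,
      hu.point_row_orthogonal hα hv a hxy.symm]
  have hpair (z : α) : pointProj u z (pair hab) = v z a + v z b :=
    (hu.isExchangeFamily z).pair_eq_point_add_point hα (hv z) hab
  have hcomm := (hu.commute_pointProj_row (pair hab) x y).eq
  have hcompress : v y b * v x a = v x a * v y b * v x a := by
    have hya := hu.point_row_orthogonal hα hv a hxy.symm
    have hxb := hu.point_row_orthogonal hα hv b hxy
    calc v y b * v x a
        = (v y a + v y b) * ((v x a + v x b) * v x a) := by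
          rw [add_mul (v x a), (hproj x a).isIdempotentElem.eq, horth x hab.symm, add_zero,
            add_mul, hya, zero_add]
      _ = (v x a + v x b) * ((v y a + v y b) * v x a) := by
          rw [← mul_assoc, ← hpair, ← hpair, ← hcomm, mul_assoc]
      _ = v x a * v y b * v x a := by
          rw [add_mul (v y a), hya, zero_add, add_mul, ← mul_assoc (v x b), hxb, zero_mul,
            add_zero, mul_assoc]
  refine ((IsSelfAdjoint.commute_iff (hproj y b).isSelfAdjoint (hproj x a).isSelfAdjoint).2 ?_).symm
  rw [hcompress]
  simpa only [(hproj x a).isSelfAdjoint.star_eq] using (hproj y b).isSelfAdjoint.conjugate (v x a)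

theorem commute_pointProj (hu : PreservesIntersections u) (hα : 5 ≤ ENat.card α) (x y : α)
    (e f : Pair α) : Commute (pointProj u x e) (pointProj u y f) := by
  choose v hv using fun z => (hu.isExchangeFamily z).exists_isPointFactor hα
  have hpair (z : α) {a b : α} (hab : a ≠ b) : pointProj u z (pair hab) = v z a + v z b :=
    (hu.isExchangeFamily z).pair_eq_point_add_point hα (hv z) hab
  have hcomm := hu.commute_point hα hv x y
  obtain ⟨a, b, hab, rfl⟩ := exists_eq_pair e
  obtain ⟨c, d, hcd, rfl⟩ := exists_eq_pair f
  rw [hpair, hpair]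
  exact ((hcomm a c).add_right (hcomm a d)).add_left ((hcomm b c).add_right (hcomm b d))

theorem commute_entries (hu : PreservesIntersections u) (hα : 5 ≤ ENat.card α)
    (e f e' f' : Pair α) : Commute (u e f) (u e' f') := by
  have hcomm := fun x y => hu.commute_pointProj hα x y e e'
  obtain ⟨x, y, hxy, rfl⟩ := exists_eq_pair f
  obtain ⟨x', y', hxy', rfl⟩ := exists_eq_pair f'
  rw [← hu.pointProj_mul_pointProj, ← hu.pointProj_mul_pointProj]
  exact ((hcomm x x').mul_right (hcomm x y')).mul_left ((hcomm y x').mul_right (hcomm y y'))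

end PreservesIntersections

end PairPermutation

section QuantumAutomorphisms

theorem IsQuantumAutomorphism.preservesIntersections {α : Type v} [DecidableEq α] {H : Type w}
    [NormedAddCommGroup H] [InnerProductSpace ℂ H] [CompleteSpace H] {k : ℕ} (hk : k < 2)
    {G : SimpleGraph (Pair α)} (hG : ∀ e f, G.Adj e f ↔ (e.1 ∩ f.1).card = k)
    {u : Pair α → Pair α → (H →L[ℂ] H)} (hu : IsQuantumAutomorphism G u) :
    PreservesIntersections u where
  row e :=
    { isStarProjection := hu.isStarProjection e
      mul_eq_zero := hu.row_orthogonal e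
      hasSum := hu.row_sum e }
  mul_eq_zero _ _ _ _ hcard :=
    hu.mul_eq_zero_of_rel_ne _ _ _ _ fun hrel => hcard (card_inter_eq_of_rel_eq hk hG hrel)

theorem QuantumAutomorphismEntriesCommute.hasNoQuantumSymmetry {V : Type v} {G : SimpleGraph V}
    (hG : QuantumAutomorphismEntriesCommute.{v, w} G) : HasNoQuantumSymmetry.{v, w} G := by
  intro H _ _ _ u hu ⟨_, hirr⟩
  have hscalar (x y : V) : ∃ c : ℂ, u x y = c • 1 :=
    hirr _ fun x' y' => hG H u hu x y x' y'
  refine finrank_eq_one_of_forall_eq_smul_one (𝕜 := ℂ) fun T => hirr T fun x y => ?_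
  obtain ⟨c, hc⟩ := hscalar x y
  rw [hc, mul_smul_comm, smul_mul_assoc, mul_one, one_mul]

end QuantumAutomorphisms

end QuantumSymmetry

open QuantumSymmetry in
theorem mainTheorem4_general {α : Type v} [DecidableEq α] (hα : 5 ≤ ENat.card α) {k : ℕ}
    (hk : k < 2) (G : SimpleGraph {s : Finset α // s.card = 2})
    (hG : ∀ s t, G.Adj s t ↔ (s.1 ∩ t.1).card = k) :
    HasNoQuantumSymmetry.{v, w} G ∧ QuantumAutomorphismEntriesCommute.{v, w} G := by
  have hcomm : QuantumAutomorphismEntriesCommute.{v, w} G := fun _ _ _ _ _ hu e f e' f' =>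
    (hu.preservesIntersections hk hG).commute_entries hα e f e' f'
  exact ⟨hcomm.hasNoQuantumSymmetry, hcomm⟩

theorem mainTheorem4 :
    (QuantumSymmetry.HasNoQuantumSymmetry.{0, w} (QuantumSymmetry.johnsonGraph 2) ∧
      QuantumSymmetry.QuantumAutomorphismEntriesCommute.{0, w} (QuantumSymmetry.johnsonGraph 2)) ∧
    (QuantumSymmetry.HasNoQuantumSymmetry.{0, w} QuantumSymmetry.kneserGraphTwo ∧
      QuantumSymmetry.QuantumAutomorphismEntriesCommute.{0, w} QuantumSymmetry.kneserGraphTwo) :=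
  ⟨mainTheorem4_general (by simp) one_lt_two _ fun _ _ => Nat.succ_inj,
    mainTheorem4_general (by simp) zero_lt_two _ fun _ _ => Finset.card_eq_zero.symm⟩
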